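/- Let $\mathcal C$ be an algebraically closed field of characteristic $0$, let $n_1,n_2\ge 0$ and $n=n_1+n_2$; matrices in $\mathcal M_n(\mathcal C)$ are written in blocks with diagonal blocks of sizes $n_1\times n_1$ and $n_2\times n_2$. A linear algebraic group is a Zariski closed subgroup $G$ of $\mathrm{GL}_n(\mathcal C)$, and its Lie algebra is the set of all $N\in\mathcal M_n(\mathcal C)$ such that $\mathrm{Id}_n+\varepsilon N$ satisfies modulo $\varepsilon^2$ all polynomial equations that hold on $G$. A Lie subalgebra of $\mathcal M_n(\mathcal C)$ is called algebraic if it is the Lie algebra of a linear algebraic group. Let $H_{\mathrm{diag}}\subset \mathrm{GL}_n(\mathcal C)$ be a (Zariski) connected linear algebraic group of block-diagonal matrices $\begin{pmatrix} H_1&0\\0&H_2\end{pmatrix}$, and let $\mathfrak h_{\mathrm{diag}}$ be its Lie algebra. Let $\mathfrak h_{\mathrm{sub}}$ be a $\mathcal C$-vector space of matrices of the form $\begin{pmatrix}0&0\\X&0\end{pmatrix}$ such that $$\begin{pmatrix}0&0\\N_2X-XN_1&0\end{pmatrix}\in\mathfrak h_{\mathrm{sub}}\quad\text{for all } \begin{pmatrix}N_1&0\\0&N_2\end{pmatrix}\in\mathfrak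 h_{\mathrm{diag}},\ \begin{pmatrix}0&0\\X&0\end{pmatrix}\in\mathfrak h_{\mathrm{sub}}.$$ Let $H_{\mathrm{sub}}=\{\mathrm{Id}_n+B : B\in\mathfrak h_{\mathrm{sub}}\}$, and let $H$ be the subgroup of $\mathrm{GL}_n(\mathcal C)$ generated by $H_{\mathrm{diag}}$ and $H_{\mathrm{sub}}$. Then $H$ is Zariski closed and connected, i.e. a connected linear algebraic group; the sum $\mathfrak h=\mathfrak h_{\mathrm{diag}}+\mathfrak h_{\mathrm{sub}}$ is direct; and the Lie algebra of $H$ is $\mathfrak h=\mathfrak h_{\mathrm{diag}}\oplus\mathfrak h_{\mathrm{sub}}$. In particular $\mathfrak h$ is an algebraic Lie algebra. -/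

import Mathlib

/- Matrices carry the commutator bracket. -/
attribute [local instance 100] LieRing.ofAssociativeRing

/-- The matrix `M`, read as the point of affine space whose coordinates are its entries. -/
def Matrix.entries {ι R : Type*} (M : Matrix ι ι R) : ι × ι → R := fun p => M p.1 p.2

namespace LinAlgGroup

open MvPolynomial

section Basic

variable {ι K : Type*} [Fintype ι] [DecidableEq ι] [Field K]

/-- The Zariski topology on `GL ι K`: the closed sets are the sets of common zeros, in `GL ι K`,
of polynomials in the matrix entries. (Allowing `1 / det` in the equations gives the same sets.) -/
@[reducible]
def zariski (ι K : Type*) [Fintype ι] [DecidableEq ι] [Field K] :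
    TopologicalSpace (GL ι K) :=
  TopologicalSpace.ofClosed
    {Z | ∃ I : Ideal (MvPolynomial (ι × ι) K),
      Z = {g : GL ι K | g.val.entries ∈ zeroLocus K I}}
    ⟨⊤, by
      ext g
      simp only [Set.mem_empty_iff_false, Set.mem_ofPred_eq, false_iff, mem_zeroLocus_iff]
      intro h
      simpa using h 1 trivial⟩
    (by
      intro A hA
      have hA' : ∀ Z ∈ A, ∃ I : Ideal (MvPolynomial (ι × ι) K),
          Z = {g : GL ι K | g.val.entries ∈ zeroLocus K I} := fun Z hZ => hA hZ
      choose! J hJ using hA'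
      refine ⟨sSup (J '' A), ?_⟩
      ext g
      simp only [Set.mem_sInter, Set.mem_ofPred_eq, mem_zeroLocus_iff]
      constructor
      · intro h
        have : sSup (J '' A) ≤ RingHom.ker (aeval (R := K) g.val.entries) := by
          refine sSup_le ?_
          rintro _ ⟨Z, hZ, rfl⟩ p hp
          have := h Z hZ
          rw [hJ Z hZ] at this
          exact this p hp
        exact fun p hp => this hp
      · intro h Z hZ
        rw [hJ Z hZ]
        exact fun p hp => h p (le_sSup (Set.mem_image_of_mem J hZ) hp))
    (by
      rintro _ ⟨I, rfl⟩ _ ⟨J, rfl⟩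
      refine ⟨I * J, ?_⟩
      ext g
      simp only [Set.mem_union, Set.mem_ofPred_eq, mem_zeroLocus_iff]
      constructor
      · rintro (h | h) p hp
        · exact h p ((Ideal.mul_le_left : I * J ≤ I) hp)
        · exact h p ((Ideal.mul_le_right : I * J ≤ J) hp)
      · intro h
        by_contra! hc
        obtain ⟨⟨p, hp, hp0⟩, q, hq, hq0⟩ := hc
        have := h _ (Ideal.mul_mem_mul hp hq)
        rw [map_mul] at this
        exact (mul_ne_zero hp0 hq0) this)

/-- A linear algebraic group: a Zariski closed subgroup of `GL ι K`. -/
def IsAlgebraicGroup (G : Subgroup (GL ι K)) : Prop :=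
  @IsClosed (GL ι K) (zariski ι K) (G : Set (GL ι K))

/-- Connectedness in the Zariski topology. -/
def IsZariskiConnected (G : Subgroup (GL ι K)) : Prop :=
  @IsConnected (GL ι K) (zariski ι K) (G : Set (GL ι K))

/-- The ideal of all polynomials in the matrix entries that vanish on `G`. -/
def ideal (G : Subgroup (GL ι K)) : Ideal (MvPolynomial (ι × ι) K) :=
  vanishingIdeal K ((fun g : GL ι K => g.val.entries) '' (G : Set (GL ι K)))

/-- The matrix `Id + ε N` over the dual numbers `K[ε]`, `ε² = 0`. -/
def onePlusEps (N : Matrix ι ι K) : Matrix ι ι (DualNumber K) :=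
  1 + (DualNumber.eps : DualNumber K) • N.map (algebraMap K (DualNumber K))

/-- `N` is tangent to `G` at the identity: `Id + ε N` satisfies the equations of `G`
modulo `ε²`. -/
def IsTangent (G : Subgroup (GL ι K)) (N : Matrix ι ι K) : Prop :=
  ∀ p ∈ ideal G, aeval (onePlusEps N).entries p = 0

theorem mem_ideal {G : Subgroup (GL ι K)} {p : MvPolynomial (ι × ι) K} :
    p ∈ ideal G ↔ ∀ g ∈ G, aeval g.val.entries p = 0 := by
  simp [ideal, mem_vanishingIdeal_iff]

theorem aeval_onePlusEps (N : Matrix ι ι K) (p : MvPolynomial (ι × ι) K) :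
    aeval (onePlusEps N).entries p =
      TrivSqZeroExt.inl (aeval (1 : Matrix ι ι K).entries p) +
      TrivSqZeroExt.inr (∑ x, N.entries x * aeval (1 : Matrix ι ι K).entries (pderiv x p)) := by
  induction p using MvPolynomial.induction_on with
  | C a => simp [TrivSqZeroExt.algebraMap_eq_inl]
  | add p q hp hq =>
    rw [map_add, hp, hq]
    simp only [map_add, mul_add, Finset.sum_add_distrib, TrivSqZeroExt.inl_add,
      TrivSqZeroExt.inr_add]
    ring
  | mul_X p x hp =>
    rw [map_mul, hp, aeval_X]
    have hx : (onePlusEps N).entries x =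
        TrivSqZeroExt.inl ((1 : Matrix ι ι K).entries x) + TrivSqZeroExt.inr (N.entries x) := by
      obtain ⟨i, j⟩ := x
      ext <;> by_cases h : i = j <;>
        simp [onePlusEps, Matrix.entries, Matrix.one_apply, h, TrivSqZeroExt.algebraMap_eq_inl]
    rw [hx]
    have hs : ∀ y, N.entries y * aeval (1 : Matrix ι ι K).entries (pderiv y (p * X x)) =
        (N.entries y * aeval (1 : Matrix ι ι K).entries (pderiv y p)) *
          (1 : Matrix ι ι K).entries x +
        (if y = x then aeval (1 : Matrix ι ι K).entries p * N.entries x else 0) := by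
      intro y
      rw [Derivation.leibniz, pderiv_X]
      by_cases h : y = x
      · subst h
        simp
        ring
      · simp [h, Ne.symm h]
        ring
    rw [Finset.sum_congr rfl (fun y _ => hs y), Finset.sum_add_distrib, ← Finset.sum_mul,
      Finset.sum_ite_eq' Finset.univ x]
    ext
    · simp
    · simp
      ring

theorem isTangent_iff {G : Subgroup (GL ι K)} {N : Matrix ι ι K} :
    IsTangent G N ↔ ∀ p ∈ ideal G,
      ∑ x, N.entries x * aeval (1 : Matrix ι ι K).entries (pderiv x p) = 0 := by
  refine forall₂_congr fun p hp => ?_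
  have h1 := mem_ideal.1 hp 1 G.one_mem
  rw [Units.val_one] at h1
  rw [aeval_onePlusEps, h1]
  simp [TrivSqZeroExt.ext_iff]

theorem onePlusEps_conj (g : GL ι K) (M : Matrix ι ι K) :
    onePlusEps (g.val * M * g⁻¹.val) =
      g.val.map (algebraMap K (DualNumber K)) * onePlusEps M *
        g⁻¹.val.map (algebraMap K (DualNumber K)) := by
  have h : g.val.map (algebraMap K (DualNumber K)) *
      g⁻¹.val.map (algebraMap K (DualNumber K)) = 1 := by
    rw [← Matrix.map_mul, ← Units.val_mul, mul_inv_cancel]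
    simp
  simp only [onePlusEps, mul_add, add_mul, mul_one, h, Matrix.map_mul, Matrix.mul_smul,
    Matrix.smul_mul]

theorem aeval_conj {A : Type*} [CommRing A] [Algebra K A] (P Q : Matrix ι ι K)
    (T : Matrix ι ι A) (p : MvPolynomial (ι × ι) K) :
    aeval T.entries (aeval (P.map C * Matrix.mvPolynomialX ι ι K * Q.map C).entries p) =
      aeval (P.map (algebraMap K A) * T * Q.map (algebraMap K A)).entries p := by
  rw [← AlgHom.comp_apply]
  congr 1
  apply MvPolynomial.algHom_ext
  intro x
  simp [Matrix.entries, Matrix.mul_apply, Matrix.mvPolynomialX_apply]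

theorem IsTangent.conj {G : Subgroup (GL ι K)} {M : Matrix ι ι K} (hM : IsTangent G M)
    {g : GL ι K} (hg : g ∈ G) : IsTangent G (g.val * M * g⁻¹.val) := by
  intro p hp
  rw [onePlusEps_conj, ← aeval_conj]
  apply hM
  rw [mem_ideal]
  intro a ha
  rw [aeval_conj]
  have := mem_ideal.1 hp (g * a * g⁻¹) (G.mul_mem (G.mul_mem hg ha) (G.inv_mem hg))
  simpa using this

/-- The tangent space at the identity, as a vector space. -/
def tangentSpace (G : Subgroup (GL ι K)) : Submodule K (Matrix ι ι K) where
  carrier := {N | IsTangent G N}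
  zero_mem' := by
    rw [Set.mem_ofPred_eq, isTangent_iff]
    intro p _
    simp [Matrix.entries]
  add_mem' := by
    intro M N hM hN
    rw [Set.mem_ofPred_eq, isTangent_iff] at *
    intro p hp
    have := congrArg₂ (· + ·) (hM p hp) (hN p hp)
    simpa [Matrix.entries, add_mul, Finset.sum_add_distrib] using this
  smul_mem' := by
    intro c M hM
    rw [Set.mem_ofPred_eq, isTangent_iff] at *
    intro p hp
    have := congrArg (c * ·) (hM p hp)
    simpa [Matrix.entries, mul_assoc, Finset.mul_sum] using this

theorem lie_mem_tangentSpace {G : Subgroup (GL ι K)} {N M : Matrix ι ι K}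
    (hN : N ∈ tangentSpace G) (hM : M ∈ tangentSpace G) : ⁅N, M⁆ ∈ tangentSpace G := by
  by_contra hc
  obtain ⟨f, hf, hle⟩ := Submodule.exists_le_ker_of_notMem hc
  have hf0 : ∀ B ∈ tangentSpace G, f B = 0 := fun B hB => hle hB
  have hsum : ∀ B : Matrix ι ι K, f B = ∑ i, ∑ j, f (Matrix.single i j 1) * B i j := by
    intro B
    conv_lhs => rw [Matrix.matrix_eq_sum_single B]
    simp only [map_sum]
    refine Finset.sum_congr rfl fun i _ => Finset.sum_congr rfl fun j _ => ?_
    have : Matrix.single i j (B i j) = B i j • Matrix.single i j (1 : K) := by simp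
    rw [this, map_smul, smul_eq_mul, mul_comm]
  let Y := Matrix.mvPolynomialX ι ι K
  let P : MvPolynomial (ι × ι) K :=
    ∑ i, ∑ j, C (f (Matrix.single i j 1)) *
      (Y * M.map (C : K → MvPolynomial (ι × ι) K) * Y.adjugate : Matrix ι ι _) i j
  have hP : ∀ {A : Type _} [CommRing A] [Algebra K A] (T : Matrix ι ι A),
      aeval T.entries P = ∑ i, ∑ j, algebraMap K A (f (Matrix.single i j 1)) *
        (T * M.map (algebraMap K A) * T.adjugate) i j := by
    intro A _ _ T
    have hY : (aeval T.entries : MvPolynomial (ι × ι) K →ₐ[K] A).mapMatrix Y = T := by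
      ext i j
      simp [Y, Matrix.entries, Matrix.mvPolynomialX_apply]
    have hMC : (aeval T.entries : MvPolynomial (ι × ι) K →ₐ[K] A).mapMatrix (M.map C) =
        M.map (algebraMap K A) := by
      ext i j
      simp
    have hall : (aeval T.entries : MvPolynomial (ι × ι) K →ₐ[K] A).mapMatrix
        (Y * M.map C * Y.adjugate) = T * M.map (algebraMap K A) * T.adjugate := by
      rw [map_mul, map_mul, hMC, AlgHom.map_adjugate, hY]
    rw [← hall]
    simp [P]
  have hPI : P ∈ ideal G := by
    rw [mem_ideal]
    intro g hg
    rw [hP]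
    have h1 := hsum (g.val * M * g.val.adjugate)
    have h2 : g.val * M * g.val.adjugate = g.val.det • (g.val * M * g⁻¹.val) := by
      have hd : g.val.det ≠ 0 := g.isUnit.map Matrix.detMonoidHom |>.ne_zero
      rw [Matrix.coe_units_inv, Matrix.inv_def, Ring.inverse_eq_inv']
      simp [smul_smul, hd]
    have h3 : f (g.val * M * g.val.adjugate) = 0 := by
      rw [h2, map_smul, hf0 _ (IsTangent.conj hM hg), smul_zero]
    rw [h1] at h3
    simpa using h3
  have key := hN P hPI
  rw [hP] at key
  let T := onePlusEps N
  let E : DualNumber K := DualNumber.eps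
  let N' := N.map (algebraMap K (DualNumber K))
  let M' := M.map (algebraMap K (DualNumber K))
  have hE : E * E = 0 := DualNumber.eps_mul_eps
  have hT : T = 1 + E • N' := rfl
  have hinv : T * (1 - E • N') = 1 := by
    rw [hT]
    simp [mul_sub, add_mul, smul_smul, hE]
  have hadj : T.adjugate = T.det • (1 - E • N') := by
    calc T.adjugate = T.adjugate * (T * (1 - E • N')) := by rw [hinv, mul_one]
      _ = _ := by rw [← mul_assoc, Matrix.adjugate_mul, Matrix.smul_mul, one_mul]
  have hconj : T * M' * T.adjugate = T.det • (M' + E • (⁅N, M⁆.map (algebraMap K _))) := by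
    rw [hadj, Matrix.mul_smul]
    congr 1
    have : ⁅N, M⁆.map (algebraMap K (DualNumber K)) = N' * M' - M' * N' := by
      rw [Ring.lie_def, Matrix.map_sub _ (map_sub _), Matrix.map_mul, Matrix.map_mul]
    rw [this, hT]
    simp [mul_sub, add_mul, smul_smul, hE, smul_sub]
    abel
  have hdet : IsUnit T.det := by
    refine IsUnit.of_mul_eq_one ((1 - E • N').det) ?_
    rw [← Matrix.det_mul, hinv, Matrix.det_one]
  have key2 : T.det * (algebraMap K (DualNumber K) (f M) +
      E * algebraMap K (DualNumber K) (f ⁅N, M⁆)) = 0 := by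
    rw [← key]
    change _ = ∑ i, ∑ j, algebraMap K (DualNumber K) (f (Matrix.single i j 1)) *
      (T * M' * T.adjugate) i j
    rw [hconj, hsum M, hsum ⁅N, M⁆]
    simp only [map_sum, map_mul, Finset.mul_sum, ← Finset.sum_add_distrib, mul_add,
      Matrix.smul_apply, Matrix.add_apply, smul_eq_mul, Matrix.map_apply, M']
    refine Finset.sum_congr rfl fun i _ => Finset.sum_congr rfl fun j _ => ?_
    ring
  rw [hdet.mul_right_eq_zero, hf0 M hM, map_zero, zero_add] at key2
  have := congrArg TrivSqZeroExt.snd key2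
  simp [E, TrivSqZeroExt.algebraMap_eq_inl] at this
  exact hf this

/-- The Lie algebra of the linear algebraic group `G`, as a Lie subalgebra of the matrices:
all `N` such that `Id + ε N` satisfies the equations of `G` modulo `ε²`. -/
def lieAlgebra (G : Subgroup (GL ι K)) : LieSubalgebra K (Matrix ι ι K) where
  toSubmodule := tangentSpace G
  lie_mem' := fun hN hM => lie_mem_tangentSpace hN hM

/-- A Lie algebra of matrices is algebraic if it is the Lie algebra of a linear algebraic
group. -/
def IsAlgebraicLie (h : LieSubalgebra K (Matrix ι ι K)) : Prop :=
  ∃ G : Subgroup (GL ι K), IsAlgebraicGroup G ∧ lieAlgebra G = h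

end Basic

section Blocks

variable {m n K : Type*} [Fintype m] [DecidableEq m] [Fintype n] [DecidableEq n] [Field K]

/-- All elements of `G` are block-diagonal, with diagonal blocks indexed by `m` and `n`. -/
def IsBlockDiagonal (G : Subgroup (GL (m ⊕ n) K)) : Prop :=
  ∀ g ∈ G, ∃ (A : Matrix m m K) (D : Matrix n n K), g.val = Matrix.fromBlocks A 0 0 D

/-- All matrices of `V` have the form `(0 0; X 0)`. -/
def IsLowerLeft (V : Submodule K (Matrix (m ⊕ n) (m ⊕ n) K)) : Prop :=
  ∀ B ∈ V, ∃ X : Matrix n m K, B = Matrix.fromBlocks 0 0 X 0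

theorem IsLowerLeft.mul_eq_zero {V : Submodule K (Matrix (m ⊕ n) (m ⊕ n) K)}
    (hV : IsLowerLeft V) {A B : Matrix (m ⊕ n) (m ⊕ n) K} (hA : A ∈ V) (hB : B ∈ V) :
    A * B = 0 := by
  obtain ⟨X, rfl⟩ := hV A hA
  obtain ⟨Y, rfl⟩ := hV B hB
  simp [Matrix.fromBlocks_multiply]

/-- The vector group `{Id + B | B ∈ V}`. -/
def vectorGroup (V : Submodule K (Matrix (m ⊕ n) (m ⊕ n) K)) (hV : IsLowerLeft V) :
    Subgroup (GL (m ⊕ n) K) where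
  carrier := {g | ∃ B ∈ V, g.val = 1 + B}
  one_mem' := ⟨0, V.zero_mem, by simp⟩
  mul_mem' := by
    rintro g h ⟨A, hA, hg⟩ ⟨B, hB, hh⟩
    refine ⟨A + B, V.add_mem hA hB, ?_⟩
    rw [Units.val_mul, hg, hh, add_mul, mul_add, mul_add, hV.mul_eq_zero hA hB]
    simp
    abel
  inv_mem' := by
    rintro g ⟨A, hA, hg⟩
    refine ⟨-A, V.neg_mem hA, ?_⟩
    refine Units.inv_eq_of_mul_eq_one_right ?_
    rw [hg, add_mul, mul_add, mul_add, hV.mul_eq_zero hA (V.neg_mem hA)]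
    simp

end Blocks

end LinAlgGroup

set_option linter.unusedSectionVars false

namespace LinAlgGroup

open MvPolynomial Topology

/-! ### Krull's intersection theorem -/

section Krull

/-- A uniform form of Krull's intersection theorem. -/
theorem exists_sub_one_mem_and_forall_smul_eq_zero {R M : Type*} [CommRing R] [IsNoetherianRing R]
    [AddCommGroup M] [Module R M] [Module.Finite R M] (I : Ideal R) (N : Submodule R M)
    (hN : ∀ k : ℕ, N ≤ I ^ k • ⊤) : ∃ r : R, r - 1 ∈ I ∧ ∀ x ∈ N, r • x = 0 := by
  -- Artin–Rees at exponent `k + 1`: both intersections equal `N`, so `N = I • N`, and Nakayama's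
  -- lemma applies.
  obtain ⟨k, hk⟩ := I.exists_pow_inf_eq_pow_smul N
  have h := hk (k + 1) (Nat.le_succ k)
  rw [inf_eq_right.2 (hN _), inf_eq_right.2 (hN _), Nat.add_sub_cancel_left, pow_one] at h
  exact Submodule.exists_sub_one_mem_and_smul_eq_zero_of_fg_of_le_smul I N
    (IsNoetherian.noetherian N) h.le

end Krull

/-! ### Zariski topology and connectedness -/

section Topology

variable {ι K : Type*} [Fintype ι] [DecidableEq ι] [Field K]

theorem isClosed_zariski_iff {Z : Set (GL ι K)} :
    IsClosed[zariski ι K] Z ↔ ∃ S : Set (MvPolynomial (ι × ι) K),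
      Z = {g : GL ι K | ∀ p ∈ S, aeval g.val.entries p = 0} := by
  have h : IsClosed[zariski ι K] Z ↔ ∃ I : Ideal (MvPolynomial (ι × ι) K),
      Z = {g : GL ι K | g.val.entries ∈ zeroLocus K I} := by
    rw [← @isOpen_compl_iff _ _ (zariski ι K)]
    change Zᶜᶜ ∈ _ ↔ _
    rw [compl_compl]
    rfl
  rw [h]
  constructor
  · rintro ⟨I, rfl⟩
    exact ⟨I, by ext g; simp [mem_zeroLocus_iff]⟩
  · rintro ⟨S, rfl⟩
    refine ⟨Ideal.span S, ?_⟩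
    ext g
    simp only [Set.mem_ofPred_eq, mem_zeroLocus_iff]
    constructor
    · intro hg
      have : Ideal.span S ≤ RingHom.ker (aeval (R := K) g.val.entries) := Ideal.span_le.2 hg
      exact fun p hp => this hp
    · exact fun hg p hp => hg p (Ideal.subset_span hp)

/-- The factor `(1 : Matrix ι ι K).map C` makes this an instance of `aeval_conj`. -/
theorem aeval_mul_left (g h : GL ι K) (p : MvPolynomial (ι × ι) K) :
    aeval h.val.entries (aeval (g.val.map C * Matrix.mvPolynomialX ι ι K *
      (1 : Matrix ι ι K).map C).entries p) = aeval (g * h).val.entries p := by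
  rw [aeval_conj]
  simp

theorem continuous_mul_left_zariski (g : GL ι K) :
    @Continuous _ _ (zariski ι K) (zariski ι K) (g * ·) := by
  let := zariski ι K
  rw [continuous_iff_isClosed]
  intro Z hZ
  obtain ⟨S, rfl⟩ := isClosed_zariski_iff.1 hZ
  refine isClosed_zariski_iff.2 ⟨(aeval (g.val.map C * Matrix.mvPolynomialX ι ι K *
      (1 : Matrix ι ι K).map C).entries) '' S, ?_⟩
  ext h
  simp only [Set.mem_preimage, Set.mem_ofPred_eq, Set.forall_mem_image, aeval_mul_left]

/-- A Zariski closed submonoid that contains the trace on a connected group `G` of a principal open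
neighbourhood of the identity contains `G`. -/
theorem le_of_isZariskiConnected {G : Subgroup (GL ι K)} (hG : IsZariskiConnected G)
    (S : Submonoid (GL ι K)) (hS : IsClosed[zariski ι K] (S : Set (GL ι K)))
    (a : MvPolynomial (ι × ι) K) (ha : aeval (1 : Matrix ι ι K).entries a ≠ 0)
    (haS : ∀ g ∈ G, aeval g.val.entries a ≠ 0 → g ∈ S) : ∀ g ∈ G, g ∈ S := by
  let := zariski ι K
  have hUo : IsOpen {g : GL ι K | aeval g.val.entries a ≠ 0} := by
    rw [← isClosed_compl_iff]
    exact isClosed_zariski_iff.2 ⟨{a}, by ext g; simp⟩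
  -- On `G` this open union of translates coincides with the closed set `S`: each element of `S ∩ G`
  -- lies in its own translate, and `S` is closed under products. So `S ∩ G` is clopen in `G`.
  have hVo : IsOpen (⋃ h ∈ (S : Set (GL ι K)) ∩ G,
      (h⁻¹ * ·) ⁻¹' {g : GL ι K | aeval g.val.entries a ≠ 0}) :=
    isOpen_biUnion fun h _ => hUo.preimage (continuous_mul_left_zariski h⁻¹)
  have hcover : ∀ g ∈ G, (g ∈ ⋃ h ∈ (S : Set (GL ι K)) ∩ G,
      (h⁻¹ * ·) ⁻¹' {g : GL ι K | aeval g.val.entries a ≠ 0}) ↔ g ∈ S := by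
    intro g hg
    simp only [Set.mem_iUnion, Set.mem_preimage, Set.mem_ofPred_eq, exists_prop]
    constructor
    · rintro ⟨h, ⟨hhS, hhG⟩, hne⟩
      have := S.mul_mem hhS (haS _ (G.mul_mem (G.inv_mem hhG) hg) hne)
      rwa [mul_inv_cancel_left] at this
    · intro hgS
      exact ⟨g, ⟨hgS, hg⟩, by simpa using ha⟩
  rcases isPreconnected_iff_subset_of_disjoint.1 hG.isPreconnected _ _ hVo hS.isOpen_compl
    (by
      intro g hg
      by_cases h : g ∈ S
      · exact Or.inl ((hcover g hg).2 h)
      · exact Or.inr h)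
    (by
      ext g
      simp only [Set.mem_inter_iff, Set.mem_empty_iff_false, iff_false]
      rintro ⟨hg, h1, h2⟩
      exact h2 ((hcover g hg).1 h1)) with h | h
  · exact fun g hg => (hcover g hg).1 (h hg)
  · exact absurd S.one_mem (h G.one_mem)

end Topology

/-! ### Invariant derivations and first order expansions -/

section Derivation

variable {ι K : Type*} [Fintype ι] [DecidableEq ι] [Field K]

/-- The left invariant derivation of the coordinate ring of matrices attached to `N`: the
derivative of `p` along `g ↦ g (1 + ε N)`. -/
noncomputable def invDeriv (N : Matrix ι ι K) :
    Derivation K (MvPolynomial (ι × ι) K) (MvPolynomial (ι × ι) K) :=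
  mkDerivation K (Matrix.mvPolynomialX ι ι K * N.map C).entries

/-- The matrix `1 + ε N` over `A[ε]`. -/
def onePlusEpsOver (A : Type*) [CommRing A] [Algebra K A] (N : Matrix ι ι K) :
    Matrix ι ι (DualNumber A) :=
  1 + (DualNumber.eps : DualNumber A) • N.map (algebraMap K (DualNumber A))

/-- The algebra `A` is arbitrary so that `T` can be a point of the group or the generic matrix. -/
theorem aeval_mul_onePlusEps {A : Type*} [CommRing A] [Algebra K A] (T : Matrix ι ι A)
    (N : Matrix ι ι K) (p : MvPolynomial (ι × ι) K) :
    aeval (T.map (algebraMap A (DualNumber A)) * onePlusEpsOver A N).entries p =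
      TrivSqZeroExt.inl (aeval T.entries p) +
        TrivSqZeroExt.inr (aeval T.entries (invDeriv N p)) := by
  induction p using MvPolynomial.induction_on with
  | C a => simp [TrivSqZeroExt.algebraMap_eq_inl']
  | add p q hp hq =>
    rw [map_add, hp, hq]
    simp only [map_add, TrivSqZeroExt.inl_add, TrivSqZeroExt.inr_add]
    ring
  | mul_X p x hp =>
    rw [map_mul, hp, aeval_X]
    have hx : (T.map (algebraMap A (DualNumber A)) * onePlusEpsOver A N).entries x =
        TrivSqZeroExt.inl (T.entries x) +
          TrivSqZeroExt.inr (aeval T.entries (invDeriv N (X x))) := by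
      obtain ⟨i, j⟩ := x
      rw [invDeriv, mkDerivation_X]
      rw [onePlusEpsOver, mul_add, mul_one, Matrix.mul_smul]
      ext <;> simp [Matrix.entries, Matrix.mul_apply, Matrix.mvPolynomialX_apply,
        TrivSqZeroExt.algebraMap_eq_inl, TrivSqZeroExt.algebraMap_eq_inl',
        ← TrivSqZeroExt.inl_mul, ← TrivSqZeroExt.inl_sum]
    rw [hx, Derivation.leibniz]
    ext
    · simp
    · simp [mul_comm]

/-- For `g ∈ G` the left translate x ↦ p(gx) again vanishes on `G`; tangency of `N` at the identity,
applied to it, is the vanishing of the derivative of `p` at `g`. -/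
theorem invDeriv_mem_ideal {G : Subgroup (GL ι K)} {N : Matrix ι ι K} (hN : IsTangent G N)
    {p : MvPolynomial (ι × ι) K} (hp : p ∈ ideal G) : invDeriv N p ∈ ideal G := by
  rw [mem_ideal]
  intro g hg
  have h1 : aeval (g.val.map C * Matrix.mvPolynomialX ι ι K *
      (1 : Matrix ι ι K).map C).entries p ∈ ideal G := by
    rw [mem_ideal]
    intro h hh
    rw [aeval_mul_left]
    exact mem_ideal.1 hp _ (G.mul_mem hg hh)
  have h2 := hN _ h1
  rw [aeval_conj] at h2
  have h3 := aeval_mul_onePlusEps g.val N p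
  have h4 : (1 : Matrix ι ι K).map (algebraMap K (DualNumber K)) = 1 := by simp
  rw [h4, mul_one] at h2
  have h5 := congrArg TrivSqZeroExt.snd (h3.symm.trans h2)
  simpa using h5

/-- The differential at the identity of a polynomial function on matrices. -/
noncomputable def differentialOne :
    MvPolynomial (ι × ι) K →ₗ[K] Module.Dual K (Matrix ι ι K) :=
  LinearMap.mk₂ K (fun p N => ∑ x, N.entries x * aeval (1 : Matrix ι ι K).entries (pderiv x p))
    (by intros; simp [mul_add, Finset.sum_add_distrib])
    (by intros; simp [Finset.mul_sum, mul_left_comm])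
    (by intros; simp [Matrix.entries, add_mul, Finset.sum_add_distrib])
    (by intros; simp [Matrix.entries, Finset.mul_sum, mul_assoc])

theorem differentialOne_apply (p : MvPolynomial (ι × ι) K) (N : Matrix ι ι K) :
    differentialOne p N =
      ∑ x, N.entries x * aeval (1 : Matrix ι ι K).entries (pderiv x p) := rfl

theorem aeval_one_invDeriv (N : Matrix ι ι K) (p : MvPolynomial (ι × ι) K) :
    aeval (1 : Matrix ι ι K).entries (invDeriv N p) = differentialOne p N := by
  have h1 := aeval_mul_onePlusEps (1 : Matrix ι ι K) N p
  have h4 : (1 : Matrix ι ι K).map (algebraMap K (DualNumber K)) = 1 := by simp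
  rw [h4, one_mul] at h1
  have h2 := congrArg TrivSqZeroExt.snd (h1.symm.trans (aeval_onePlusEps N p))
  simpa [differentialOne_apply] using h2

theorem tangentSpace_eq_dualCoannihilator (G : Subgroup (GL ι K)) :
    tangentSpace G =
      (((ideal G).restrictScalars K).map differentialOne).dualCoannihilator := by
  ext N
  rw [Submodule.mem_dualCoannihilator]
  change IsTangent G N ↔ _
  rw [isTangent_iff]
  simp [differentialOne_apply]

/-- The ideal of polynomials in the matrix entries vanishing at the identity. -/
noncomputable def idealOne (ι K : Type*) [DecidableEq ι] [Field K] :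
    Ideal (MvPolynomial (ι × ι) K) :=
  RingHom.ker (aeval (R := K) (1 : Matrix ι ι K).entries)

theorem mem_idealOne {p : MvPolynomial (ι × ι) K} :
    p ∈ idealOne ι K ↔ aeval (1 : Matrix ι ι K).entries p = 0 := Iff.rfl

theorem sub_C_aeval_one_mem (p : MvPolynomial (ι × ι) K) :
    p - C (aeval (1 : Matrix ι ι K).entries p) ∈ idealOne ι K := by
  simp [mem_idealOne]

/-- The remainder of `p * X x` is (p - p(1)) (X x - x(1)), a product of two elements of the ideal,
plus the constant x(1) times the remainder of `p`. -/
theorem taylor_one_mem (p : MvPolynomial (ι × ι) K) :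
    p - C (aeval (1 : Matrix ι ι K).entries p) -
      ∑ x, C (aeval (1 : Matrix ι ι K).entries (pderiv x p)) *
        (X x - C ((1 : Matrix ι ι K).entries x)) ∈ idealOne ι K ^ 2 := by
  induction p using MvPolynomial.induction_on with
  | C a => simp
  | add p q hp hq =>
    convert! Ideal.add_mem _ hp hq using 1
    simp only [map_add, add_mul, Finset.sum_add_distrib]
    ring
  | mul_X p x hp =>
    have h1 : (p - C (aeval (1 : Matrix ι ι K).entries p)) *
        (X x - C ((1 : Matrix ι ι K).entries x)) ∈ idealOne ι K ^ 2 := by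
      rw [pow_two]
      refine Ideal.mul_mem_mul (sub_C_aeval_one_mem p) ?_
      simpa using sub_C_aeval_one_mem (X x : MvPolynomial (ι × ι) K)
    have h2 := Ideal.mul_mem_left _ (C ((1 : Matrix ι ι K).entries x)) hp
    convert! Ideal.add_mem _ h1 h2 using 1
    have hs : ∀ y, C (aeval (1 : Matrix ι ι K).entries (pderiv y (p * X x))) *
        (X y - C ((1 : Matrix ι ι K).entries y)) =
        C ((1 : Matrix ι ι K).entries x) *
          (C (aeval (1 : Matrix ι ι K).entries (pderiv y p)) *
            (X y - C ((1 : Matrix ι ι K).entries y))) +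
        (if y = x then C (aeval (1 : Matrix ι ι K).entries p) *
          (X x - C ((1 : Matrix ι ι K).entries x)) else 0) := by
      intro y
      rw [Derivation.leibniz, pderiv_X]
      by_cases h : y = x
      · subst h
        simp
        ring
      · simp [h, Ne.symm h]
        ring
    rw [Finset.sum_congr rfl (fun y _ => hs y), Finset.sum_add_distrib, ← Finset.mul_sum,
      Finset.sum_ite_eq' Finset.univ x]
    simp
    ring

theorem mem_idealOne_sq {p : MvPolynomial (ι × ι) K} (hp : p ∈ idealOne ι K)
    (hd : differentialOne p = 0) : p ∈ idealOne ι K ^ 2 := by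
  have h := taylor_one_mem p
  have h0 : ∀ x, aeval (1 : Matrix ι ι K).entries (pderiv x p) = 0 := by
    rintro ⟨i, j⟩
    have := congrArg (· (Matrix.single i j (1 : K))) hd
    simpa [differentialOne_apply, Matrix.entries, Matrix.single_apply, Fintype.sum_prod_type,
      ite_and] using this
  rw [mem_idealOne] at hp
  simpa [h0, hp] using h

/-- A polynomial that vanishes to first order along the Lie algebra of `G` is a second order
perturbation of an equation of `G`. -/
theorem mem_idealOne_sq_sup_ideal {G : Subgroup (GL ι K)} {p : MvPolynomial (ι × ι) K}
    (hp : p ∈ idealOne ι K) (hd : ∀ N ∈ tangentSpace G, differentialOne p N = 0) :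
    p ∈ idealOne ι K ^ 2 ⊔ ideal G := by
  -- By double annihilators in finite dimension, the linear forms that kill the Lie algebra are
  -- exactly the differentials of equations of `G`.
  have h : differentialOne p ∈ ((ideal G).restrictScalars K).map (differentialOne (ι := ι)) := by
    rw [← Subspace.dualCoannihilator_dualAnnihilator_eq
      (W := ((ideal G).restrictScalars K).map differentialOne),
      ← tangentSpace_eq_dualCoannihilator, Submodule.mem_dualAnnihilator]
    exact hd
  obtain ⟨q, hq, hqp⟩ := h
  have hq' : q ∈ ideal G := hq
  have hq1 : q ∈ idealOne ι K := by
    have := mem_ideal.1 hq' 1 G.one_mem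
    rwa [Units.val_one] at this
  have := mem_idealOne_sq (Ideal.sub_mem _ hp hq1) (by rw [map_sub, hqp, sub_self])
  rw [← sub_add_cancel p q]
  exact Ideal.add_mem _ (Ideal.mem_sup_left this) (Ideal.mem_sup_right hq')

end Derivation

/-! ### The Euler field and vanishing to infinite order -/

section Euler

variable {ι K : Type*} [Fintype ι] [DecidableEq ι] [Field K]

theorem X_sub_C_mem_idealOne (x : ι × ι) :
    (X x - C ((1 : Matrix ι ι K).entries x) : MvPolynomial (ι × ι) K) ∈ idealOne ι K := by
  simp [mem_idealOne]

/-- The Euler vector field at the identity, along the image of `π`. -/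
noncomputable def euler (π : Matrix ι ι K →ₗ[K] Matrix ι ι K) :
    Derivation K (MvPolynomial (ι × ι) K) (MvPolynomial (ι × ι) K) :=
  ∑ x : ι × ι, (X x - C ((1 : Matrix ι ι K).entries x) : MvPolynomial (ι × ι) K) •
    invDeriv (π (Matrix.single x.1 x.2 1))

theorem euler_apply (π : Matrix ι ι K →ₗ[K] Matrix ι ι K) (p : MvPolynomial (ι × ι) K) :
    euler π p = ∑ x : ι × ι, (X x - C ((1 : Matrix ι ι K).entries x)) *
      invDeriv (π (Matrix.single x.1 x.2 1)) p := by
  change Derivation.coeFnAddMonoidHom (euler π) p = _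
  rw [euler, map_sum, Finset.sum_apply]
  rfl

theorem sum_entries_smul_single (N : Matrix ι ι K) :
    ∑ x : ι × ι, N.entries x • Matrix.single x.1 x.2 (1 : K) = N := by
  conv_rhs => rw [Matrix.matrix_eq_sum_single N]
  simp [Fintype.sum_prod_type, Matrix.entries]

theorem differentialOne_linear (c : ι × ι → K) (N : Matrix ι ι K) :
    differentialOne (∑ x, C (c x) * (X x - C ((1 : Matrix ι ι K).entries x))) N =
      ∑ x, N.entries x * c x := by
  rw [differentialOne_apply]
  refine Finset.sum_congr rfl fun y _ => ?_
  congr 1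
  rw [map_sum, map_sum, Finset.sum_eq_single y]
  · simp
  · intro x _ hx
    simp [Derivation.leibniz, pderiv_X, hx]
  · simp

variable {G : Subgroup (GL ι K)} {π : Matrix ι ι K →ₗ[K] Matrix ι ι K}

theorem euler_mem_ideal (hπ : ∀ N, π N ∈ tangentSpace G) {p : MvPolynomial (ι × ι) K}
    (hp : p ∈ ideal G) : euler π p ∈ ideal G := by
  rw [euler_apply]
  exact Ideal.sum_mem _ fun x _ => Ideal.mul_mem_left _ _ (invDeriv_mem_ideal (hπ _) hp)

/-- Freezing each invariant derivative of `p` at its value at the identity gives a linear `q`, with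
an error of second order. Since `π` fixes the Lie algebra, `q` and `p` have the same differential
along it. -/
theorem euler_sub_mem (hπ' : ∀ N ∈ tangentSpace G, π N = N)
    {p : MvPolynomial (ι × ι) K} (hp : p ∈ idealOne ι K) :
    euler π p - p ∈ idealOne ι K ^ 2 ⊔ ideal G := by
  set q : MvPolynomial (ι × ι) K := ∑ x, C (differentialOne p (π (Matrix.single x.1 x.2 1))) *
    (X x - C ((1 : Matrix ι ι K).entries x)) with hq
  have hqM : q ∈ idealOne ι K :=
    Ideal.sum_mem _ fun x _ => Ideal.mul_mem_left _ _ (X_sub_C_mem_idealOne x)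
  have h1 : euler π p - q ∈ idealOne ι K ^ 2 := by
    rw [euler_apply, hq, ← Finset.sum_sub_distrib]
    refine Ideal.sum_mem _ fun x _ => ?_
    rw [mul_comm (C _), ← mul_sub, pow_two, ← aeval_one_invDeriv]
    exact Ideal.mul_mem_mul (X_sub_C_mem_idealOne x) (sub_C_aeval_one_mem _)
  have h2 : q - p ∈ idealOne ι K ^ 2 ⊔ ideal G := by
    refine mem_idealOne_sq_sup_ideal (Ideal.sub_mem _ hqM hp) fun N hN => ?_
    rw [map_sub, LinearMap.sub_apply, hq, differentialOne_linear]
    conv_lhs => enter [2]; rw [← hπ' N hN, ← sum_entries_smul_single N]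
    simp only [map_sum, map_smul, smul_eq_mul, sub_self]
  rw [← sub_add_sub_cancel _ q]
  exact Ideal.add_mem _ (Ideal.mem_sup_left h1) h2

theorem mul_mem_mul_sup {R : Type*} [CommRing R] {I J L : Ideal R} {a b : R} (ha : a ∈ I)
    (hb : b ∈ J ⊔ L) : a * b ∈ I * J ⊔ L := by
  obtain ⟨u, hu, v, hv, rfl⟩ := Submodule.mem_sup.1 hb
  rw [mul_add]
  exact Ideal.add_mem _ (Ideal.mem_sup_left (Ideal.mul_mem_mul ha hu))
    (Ideal.mem_sup_right (Ideal.mul_mem_left _ _ hv))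

/-- By the Leibniz rule eigenvalues add under products: the Euler field acts as 1 on the ideal of
the identity to first order, hence as `k` on its `k`-th power. The summand `ideal G` is harmless
because the field preserves it. -/
theorem euler_sub_natCast_mul_mem (hπ : ∀ N, π N ∈ tangentSpace G)
    (hπ' : ∀ N ∈ tangentSpace G, π N = N) (k : ℕ) {p : MvPolynomial (ι × ι) K}
    (hp : p ∈ idealOne ι K ^ k ⊔ ideal G) :
    euler π p - k * p ∈ idealOne ι K ^ (k + 1) ⊔ ideal G := by
  have hpow : ∀ (k : ℕ) (p : MvPolynomial (ι × ι) K), p ∈ idealOne ι K ^ k →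
      euler π p - k * p ∈ idealOne ι K ^ (k + 1) ⊔ ideal G := by
    intro k
    induction k with
    | zero =>
      intro p _
      refine Ideal.mem_sup_left ?_
      rw [euler_apply, Nat.cast_zero, zero_mul, sub_zero, zero_add, pow_one]
      exact Ideal.sum_mem _ fun x _ => Ideal.mul_mem_right _ _ (X_sub_C_mem_idealOne x)
    | succ k ih =>
      intro p hp
      rw [pow_succ] at hp
      induction hp using Submodule.mul_induction_on' with
      | mem_mul_mem a ha b hb =>
        have e : euler π (a * b) - ((k + 1 : ℕ) : MvPolynomial (ι × ι) K) * (a * b) =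
            a * (euler π b - b) + (euler π a - k * a) * b := by
          rw [Derivation.leibniz, smul_eq_mul, smul_eq_mul]
          push_cast
          ring
        rw [e]
        refine Ideal.add_mem _ ?_ ?_
        · have := mul_mem_mul_sup ha (euler_sub_mem (π := π) hπ' hb)
          rwa [← pow_add] at this
        · have := mul_mem_mul_sup hb (ih a ha)
          rwa [← pow_succ', mul_comm] at this
      | add a _ b _ iha ihb =>
        convert! Ideal.add_mem _ iha ihb using 1
        rw [map_add]
        ring
  obtain ⟨u, hu, v, hv, rfl⟩ := Submodule.mem_sup.1 hp
  have e : euler π (u + v) - k * (u + v) = (euler π u - k * u) + (euler π v - k * v) := by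
    rw [map_add]
    ring
  rw [e]
  exact Ideal.add_mem _ (hpow k u hu) (Ideal.mem_sup_right
    (Ideal.sub_mem _ (euler_mem_ideal hπ hv) (Ideal.mul_mem_left _ _ hv)))

/-- In characteristic zero, functions on `G` that vanish at the identity together with all their
iterated invariant derivatives vanish at the identity to infinite order. -/
theorem le_pow_sup_ideal [CharZero K] (F : Ideal (MvPolynomial (ι × ι) K))
    (hF : F ≤ idealOne ι K)
    (hD : ∀ N ∈ tangentSpace G, ∀ p ∈ F, invDeriv N p ∈ F) (k : ℕ) :
    F ≤ idealOne ι K ^ (k + 1) ⊔ ideal G := by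
  -- `π` is a linear projection of the matrices onto the Lie algebra.
  obtain ⟨σ, hσ⟩ := (tangentSpace G).subtype.exists_leftInverse_of_injective
    (Submodule.ker_subtype _)
  set π : Matrix ι ι K →ₗ[K] Matrix ι ι K := (tangentSpace G).subtype ∘ₗ σ with hπdef
  have hπ : ∀ N, π N ∈ tangentSpace G := fun N => (σ N).2
  have hπ' : ∀ N ∈ tangentSpace G, π N = N := fun N hN =>
    congrArg Subtype.val (LinearMap.congr_fun hσ ⟨N, hN⟩)
  induction k with
  | zero => exact hF.trans (by rw [zero_add, pow_one]; exact le_sup_left)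
  | succ k ih =>
    intro p hp
    have h1 := euler_sub_natCast_mul_mem hπ hπ' (k + 1) (ih hp)
    -- The derivatives of `p` stay in `F`, to which the induction hypothesis applies, and the
    -- coefficients of the Euler field vanish at the identity: this gains one order. Comparison with
    -- `h1` leaves `(k + 1) * p`, and `k + 1` is invertible in characteristic zero.
    have h2 : euler π p ∈ idealOne ι K ^ (k + 1 + 1) ⊔ ideal G := by
      rw [euler_apply]
      refine Ideal.sum_mem _ fun x _ => ?_
      have := mul_mem_mul_sup (X_sub_C_mem_idealOne x)
        (ih (hD _ (hπ (Matrix.single x.1 x.2 1)) p hp))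
      rwa [← pow_succ'] at this
    have h3 := Ideal.mul_mem_left _ (C ((k + 1 : ℕ) : K)⁻¹) (Ideal.sub_mem _ h2 h1)
    have hk : ((k + 1 : ℕ) : K) ≠ 0 := Nat.cast_ne_zero.2 k.succ_ne_zero
    rwa [sub_sub_cancel, ← mul_assoc, ← map_natCast (C : K →+* MvPolynomial (ι × ι) K),
      ← map_mul, inv_mul_cancel₀ hk, map_one, one_mul] at h3

/-- Krull's theorem for the image of `F` in the coordinate ring of `G`; the multiplier is 1 at the
identity. So `F` vanishes on the points of `G` where `a` is nonzero. -/
theorem exists_mul_mem_ideal [CharZero K] (F : Ideal (MvPolynomial (ι × ι) K))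
    (hF : F ≤ idealOne ι K)
    (hD : ∀ N ∈ tangentSpace G, ∀ p ∈ F, invDeriv N p ∈ F) :
    ∃ a : MvPolynomial (ι × ι) K, aeval (1 : Matrix ι ι K).entries a ≠ 0 ∧
      ∀ p ∈ F, a * p ∈ ideal G := by
  obtain ⟨r, hr, hr0⟩ := exists_sub_one_mem_and_forall_smul_eq_zero (idealOne ι K)
    (Submodule.map (ideal G).mkQ F) (by
      rintro k _ ⟨p, hp, rfl⟩
      obtain ⟨u, hu, v, hv, rfl⟩ := Submodule.mem_sup.1 (le_pow_sup_ideal F hF hD k hp)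
      have hv0 : (ideal G).mkQ v = 0 := (Submodule.Quotient.mk_eq_zero _).2 hv
      have hu1 : (ideal G).mkQ u = u • (ideal G).mkQ 1 := by
        rw [← map_smul, smul_eq_mul, mul_one]
      rw [map_add, hv0, add_zero, hu1]
      exact Submodule.smul_mem_smul (Ideal.pow_le_pow_right (Nat.le_succ k) hu) trivial)
  refine ⟨r, ?_, fun p hp => ?_⟩
  · rw [mem_idealOne, map_sub, map_one, sub_eq_zero] at hr
    rw [hr]
    exact one_ne_zero
  · have := hr0 _ (Submodule.mem_map_of_mem hp)
    rw [← map_smul] at this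
    exact (Submodule.Quotient.mk_eq_zero _).1 this

end Euler

/-! ### Polynomial equations for conjugation -/

section Forms

variable {ι K : Type*} [Fintype ι] [DecidableEq ι] [Field K]

/-- The extension of scalars of a linear form on matrices. -/
noncomputable def formOver (φ : Module.Dual K (Matrix ι ι K)) (A : Type*) [CommRing A]
    [Algebra K A] : Matrix ι ι A →ₗ[A] A where
  toFun Q := ∑ x : ι × ι, algebraMap K A (φ (Matrix.single x.1 x.2 1)) * Q x.1 x.2
  map_add' := by intros; simp [mul_add, Finset.sum_add_distrib]
  map_smul' := by intros; simp [Finset.mul_sum, mul_left_comm]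

theorem formOver_apply (φ : Module.Dual K (Matrix ι ι K)) {A : Type*} [CommRing A]
    [Algebra K A] (Q : Matrix ι ι A) :
    formOver φ A Q =
      ∑ x : ι × ι, algebraMap K A (φ (Matrix.single x.1 x.2 1)) * Q x.1 x.2 := rfl

theorem map_formOver (φ : Module.Dual K (Matrix ι ι K)) {A B : Type*} [CommRing A]
    [Algebra K A] [CommRing B] [Algebra K B] (f : A →ₐ[K] B) (Q : Matrix ι ι A) :
    f (formOver φ A Q) = formOver φ B (f.mapMatrix Q) := by
  simp [formOver_apply]

theorem formOver_self (φ : Module.Dual K (Matrix ι ι K)) (Q : Matrix ι ι K) :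
    formOver φ K Q = φ Q := by
  conv_rhs => rw [← sum_entries_smul_single Q]
  simp only [map_sum, map_smul, smul_eq_mul]
  simp [formOver_apply, Matrix.entries, mul_comm]

/-- Turns membership in a subspace into linear equations, which become polynomial equations on the
group. -/
theorem mem_iff_forall_dualAnnihilator {V : Type*} [AddCommGroup V] [Module K V]
    (W : Submodule K V) (v : V) : v ∈ W ↔ ∀ φ ∈ W.dualAnnihilator, φ v = 0 := by
  rw [← Submodule.mem_dualCoannihilator, Subspace.dualAnnihilator_dualCoannihilator_eq]

theorem mapMatrix_aeval_mvPolynomialX {A : Type*} [CommRing A] [Algebra K A] (T : Matrix ι ι A) :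
    (aeval T.entries : MvPolynomial (ι × ι) K →ₐ[K] A).mapMatrix (Matrix.mvPolynomialX ι ι K) =
      T := by
  ext i j
  simp [Matrix.entries, Matrix.mvPolynomialX_apply]

theorem mapMatrix_map_C {A : Type*} [CommRing A] [Algebra K A]
    (f : MvPolynomial (ι × ι) K →ₐ[K] A) (B : Matrix ι ι K) :
    f.mapMatrix (B.map C) = B.map (algebraMap K A) := by
  ext i j
  exact f.commutes (B i j)

/-- The polynomial function `g ↦ φ (g B adj(g))`. -/
noncomputable def conjForm (φ : Module.Dual K (Matrix ι ι K)) (B : Matrix ι ι K) :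
    MvPolynomial (ι × ι) K :=
  formOver φ _ (Matrix.mvPolynomialX ι ι K * B.map C * (Matrix.mvPolynomialX ι ι K).adjugate)

theorem aeval_conjForm (φ : Module.Dual K (Matrix ι ι K)) (B : Matrix ι ι K)
    {A : Type*} [CommRing A] [Algebra K A] (T : Matrix ι ι A) :
    aeval T.entries (conjForm φ B) =
      formOver φ A (T * B.map (algebraMap K A) * T.adjugate) := by
  have h : (aeval T.entries : MvPolynomial (ι × ι) K →ₐ[K] A).mapMatrix
      (Matrix.mvPolynomialX ι ι K * B.map C * (Matrix.mvPolynomialX ι ι K).adjugate) =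
      T * B.map (algebraMap K A) * T.adjugate := by
    rw [map_mul, map_mul, mapMatrix_map_C, AlgHom.map_adjugate, mapMatrix_aeval_mvPolynomialX]
  rw [conjForm, map_formOver, h]

theorem adjugate_eq_det_smul_inv (g : GL ι K) : g.val.adjugate = g.val.det • g⁻¹.val := by
  calc g.val.adjugate = g.val.adjugate * (g.val * g⁻¹.val) := by
        rw [← Units.val_mul, mul_inv_cancel, Units.val_one, mul_one]
    _ = _ := by rw [← mul_assoc, Matrix.adjugate_mul, Matrix.smul_mul, one_mul]

theorem det_ne_zero (g : GL ι K) : g.val.det ≠ 0 :=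
  (g.isUnit.map Matrix.detMonoidHom).ne_zero

theorem aeval_conjForm_eq_zero_iff (φ : Module.Dual K (Matrix ι ι K)) (B : Matrix ι ι K)
    (g : GL ι K) :
    aeval g.val.entries (conjForm φ B) = 0 ↔ φ (g.val * B * g⁻¹.val) = 0 := by
  have hB : B.map (algebraMap K K) = B := by ext; simp
  rw [aeval_conjForm, formOver_self, hB, adjugate_eq_det_smul_inv, Matrix.mul_smul, map_smul,
    smul_eq_mul, mul_eq_zero, or_iff_right (det_ne_zero g)]

theorem adjugate_onePlusEpsOver (A : Type*) [CommRing A] [Algebra K A] (N : Matrix ι ι K) :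
    (onePlusEpsOver A N).adjugate = (onePlusEpsOver A N).det •
      (1 - (DualNumber.eps : DualNumber A) • N.map (algebraMap K (DualNumber A))) := by
  have hinv : onePlusEpsOver A N *
      (1 - (DualNumber.eps : DualNumber A) • N.map (algebraMap K (DualNumber A))) = 1 := by
    simp [onePlusEpsOver, mul_sub, add_mul, smul_smul, DualNumber.eps_mul_eps]
  calc (onePlusEpsOver A N).adjugate = (onePlusEpsOver A N).adjugate * (onePlusEpsOver A N *
      (1 - (DualNumber.eps : DualNumber A) • N.map (algebraMap K (DualNumber A)))) := by
        rw [hinv, mul_one]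
    _ = _ := by rw [← mul_assoc, Matrix.adjugate_mul, Matrix.smul_mul, one_mul]

/-- Since ε² = 0, conjugation by 1 + εN sends B to B + ε(NB - BN); the determinant appears because
the adjugate replaces the inverse. -/
theorem conj_onePlusEpsOver {A : Type*} [CommRing A] [Algebra K A] (Y : Matrix ι ι (DualNumber A))
    (N B : Matrix ι ι K) :
    Y * onePlusEpsOver A N * B.map (algebraMap K (DualNumber A)) *
        (Y * onePlusEpsOver A N).adjugate =
      (onePlusEpsOver A N).det • (Y * B.map (algebraMap K (DualNumber A)) * Y.adjugate +
        (DualNumber.eps : DualNumber A) •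
          (Y * (N * B - B * N).map (algebraMap K (DualNumber A)) * Y.adjugate)) := by
  set E : DualNumber A := DualNumber.eps
  have hE : E * E = 0 := DualNumber.eps_mul_eps
  set N' := N.map (algebraMap K (DualNumber A))
  set B' := B.map (algebraMap K (DualNumber A))
  have h : onePlusEpsOver A N * B' * (1 - E • N') = B' + E • (N' * B' - B' * N') := by
    change (1 + E • N') * B' * (1 - E • N') = _
    simp only [add_mul, one_mul, mul_sub, mul_one, Matrix.smul_mul, Matrix.mul_smul, smul_smul,
      hE, zero_smul, smul_sub]
    abel
  rw [Matrix.adjugate_mul_distrib, adjugate_onePlusEpsOver, Matrix.smul_mul, Matrix.mul_smul,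
    Matrix.map_sub _ (map_sub _), Matrix.map_mul, Matrix.map_mul]
  congr 1
  calc Y * onePlusEpsOver A N * B' * ((1 - E • N') * Y.adjugate)
      = Y * (onePlusEpsOver A N * B' * (1 - E • N')) * Y.adjugate := by simp only [mul_assoc]
    _ = _ := by rw [h, mul_add, add_mul, Matrix.mul_smul, Matrix.smul_mul]

/-- Compare ε-parts in `conj_onePlusEpsOver`. The coefficients are the two components of det(1 +
εN); their values are irrelevant for membership in an ideal. -/
theorem aeval_invDeriv_conjForm (φ : Module.Dual K (Matrix ι ι K)) (N B : Matrix ι ι K)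
    {A : Type*} [CommRing A] [Algebra K A] (Y : Matrix ι ι A) :
    ∃ c d : A, aeval Y.entries (invDeriv N (conjForm φ B)) =
      c * aeval Y.entries (conjForm φ (N * B - B * N)) + d * aeval Y.entries (conjForm φ B) := by
  have hY : ∀ p : MvPolynomial (ι × ι) K,
      aeval (Y.map (algebraMap A (DualNumber A))).entries p =
        algebraMap A (DualNumber A) (aeval Y.entries p) := fun p =>
    aeval_algebraMap_apply (DualNumber A) Y.entries p
  have h := aeval_mul_onePlusEps Y N (conjForm φ B)
  rw [aeval_conjForm, conj_onePlusEpsOver, map_smul, map_add, map_smul, ← aeval_conjForm,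
    ← aeval_conjForm, hY, hY] at h
  refine ⟨(onePlusEpsOver A N).det.fst, (onePlusEpsOver A N).det.snd, ?_⟩
  have h' := congrArg TrivSqZeroExt.snd h
  simp only [smul_eq_mul, TrivSqZeroExt.snd_mul, TrivSqZeroExt.snd_add, TrivSqZeroExt.fst_add,
    TrivSqZeroExt.fst_mul, TrivSqZeroExt.algebraMap_eq_inl, TrivSqZeroExt.fst_inl,
    TrivSqZeroExt.snd_inl, TrivSqZeroExt.snd_inr, DualNumber.fst_eps, DualNumber.snd_eps,
    MulOpposite.smul_eq_mul_unop, MulOpposite.unop_op, zero_add, mul_zero, zero_mul, add_zero,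
    one_mul] at h'
  exact h'.symm

theorem invDeriv_conjForm (φ : Module.Dual K (Matrix ι ι K)) (N B : Matrix ι ι K) :
    ∃ c d : MvPolynomial (ι × ι) K,
      invDeriv N (conjForm φ B) = c * conjForm φ (N * B - B * N) + d * conjForm φ B := by
  obtain ⟨c, d, h⟩ := aeval_invDeriv_conjForm φ N B (Matrix.mvPolynomialX ι ι K)
  have hX : ∀ p : MvPolynomial (ι × ι) K, aeval (Matrix.mvPolynomialX ι ι K).entries p = p :=
    aeval_X_left_apply
  rw [hX, hX, hX] at h
  exact ⟨c, d, h⟩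

end Forms

/-! ### From Lie algebra stability to group stability -/

section Stability

variable {ι K : Type*} [Fintype ι] [DecidableEq ι] [Field K]

/-- The submonoid of matrices that conjugate the space `W` into itself. -/
def conjStabilizer (W : Submodule K (Matrix ι ι K)) : Submonoid (GL ι K) where
  carrier := {g | ∀ B ∈ W, g.val * B * g⁻¹.val ∈ W}
  one_mem' := by
    intro B hB
    simpa using hB
  mul_mem' := by
    intro g h hg hh B hB
    have := hg _ (hh B hB)
    rw [mul_inv_rev, Units.val_mul, Units.val_mul]
    simpa only [mul_assoc] using this

/-- The equations of the stabilizer of `W` under conjugation. -/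
def conjEquations (W : Submodule K (Matrix ι ι K)) : Set (MvPolynomial (ι × ι) K) :=
  {p | ∃ φ ∈ W.dualAnnihilator, ∃ B ∈ W, p = conjForm φ B}

theorem mem_conjStabilizer_iff (W : Submodule K (Matrix ι ι K)) (g : GL ι K) :
    g ∈ conjStabilizer W ↔ ∀ p ∈ conjEquations W, aeval g.val.entries p = 0 := by
  constructor
  · rintro hg _ ⟨φ, hφ, B, hB, rfl⟩
    rw [aeval_conjForm_eq_zero_iff]
    exact (mem_iff_forall_dualAnnihilator W _).1 (hg B hB) φ hφ
  · intro hg B hB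
    rw [mem_iff_forall_dualAnnihilator]
    intro φ hφ
    rw [← aeval_conjForm_eq_zero_iff]
    exact hg _ ⟨φ, hφ, B, hB, rfl⟩

/-- In characteristic zero, a space of matrices that is stable under the adjoint action of the
Lie algebra of a connected group is stable under conjugation by the group. -/
theorem conj_mem_of_lie_mem [CharZero K] {G : Subgroup (GL ι K)} (hG : IsZariskiConnected G)
    {W : Submodule K (Matrix ι ι K)}
    (hW : ∀ N ∈ tangentSpace G, ∀ B ∈ W, N * B - B * N ∈ W) :
    ∀ g ∈ G, ∀ B ∈ W, g.val * B * g⁻¹.val ∈ W := by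
  have hone : ∀ p ∈ conjEquations W, p ∈ idealOne ι K := by
    intro p hp
    have := (mem_conjStabilizer_iff W 1).1 (conjStabilizer W).one_mem p hp
    rwa [Units.val_one] at this
  -- The ideal is stable under derivation because differentiating the equation attached to B yields
  -- those attached to NB - BN and B, and `W` contains both matrices.
  obtain ⟨a, ha, haF⟩ := exists_mul_mem_ideal (G := G) (Ideal.span (conjEquations W))
    (Ideal.span_le.2 hone) (by
      intro N hN p hp
      induction hp using Submodule.span_induction with
      | mem p hp =>
        obtain ⟨φ, hφ, B, hB, rfl⟩ := hp
        obtain ⟨c, d, h⟩ := invDeriv_conjForm φ N B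
        rw [h]
        exact Ideal.add_mem _
          (Ideal.mul_mem_left _ _ (Ideal.subset_span ⟨φ, hφ, _, hW N hN B hB, rfl⟩))
          (Ideal.mul_mem_left _ _ (Ideal.subset_span ⟨φ, hφ, B, hB, rfl⟩))
      | zero => rw [map_zero]; exact Ideal.zero_mem _
      | add p q _ _ hp hq => rw [map_add]; exact Ideal.add_mem _ hp hq
      | smul c p hp' hp =>
        rw [smul_eq_mul, Derivation.leibniz]
        exact Ideal.add_mem _ (Ideal.mul_mem_left _ _ hp)
          (Ideal.mul_mem_right _ _ hp'))
  refine le_of_isZariskiConnected hG (conjStabilizer W) ?_ a ha ?_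
  · exact isClosed_zariski_iff.2 ⟨conjEquations W, Set.ext fun g => mem_conjStabilizer_iff W g⟩
  · intro g hg hga
    rw [mem_conjStabilizer_iff]
    intro p hp
    have := mem_ideal.1 (haF p (Ideal.subset_span hp)) g hg
    rw [map_mul] at this
    exact (mul_eq_zero.1 this).resolve_left hga

end Stability

/-! ### Lines through the identity -/

section General

variable {ι K : Type*} [Fintype ι] [DecidableEq ι] [Field K]

theorem formOver_map_algebraMap (φ : Module.Dual K (Matrix ι ι K)) (A : Type*) [CommRing A]
    [Algebra K A] (Q : Matrix ι ι K) :
    formOver φ A (Q.map (algebraMap K A)) = algebraMap K A (φ Q) := by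
  have := map_formOver φ (Algebra.ofId K A) Q
  rw [formOver_self] at this
  exact this.symm

theorem IsTangent.mono {G H : Subgroup (GL ι K)} (hGH : G ≤ H) {N : Matrix ι ι K}
    (hN : IsTangent G N) : IsTangent H N :=
  fun p hp => hN p (mem_ideal.2 fun g hg => mem_ideal.1 hp g (hGH hg))

theorem IsAlgebraicGroup.mem_of_forall_ideal {G : Subgroup (GL ι K)} (hG : IsAlgebraicGroup G)
    {g : GL ι K} (hg : ∀ p ∈ ideal G, aeval g.val.entries p = 0) : g ∈ G := by
  obtain ⟨S, hS⟩ := isClosed_zariski_iff.1 hG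
  have hmem : ∀ h : GL ι K, h ∈ G ↔ ∀ p ∈ S, aeval h.val.entries p = 0 := fun h => by
    rw [← SetLike.mem_coe, hS]
    rfl
  exact (hmem g).2 fun p hp => hg p (mem_ideal.2 fun h hh => (hmem h).1 hh p hp)

/-- The generic point `1 + t B` of the line through the identity in the direction `B`. -/
noncomputable def line (B : Matrix ι ι K) : Matrix ι ι (Polynomial K) :=
  1 + (Polynomial.X : Polynomial K) • B.map (algebraMap K (Polynomial K))

theorem map_aeval_line {A : Type*} [CommRing A] [Algebra K A] (f : Polynomial K →ₐ[K] A)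
    (B : Matrix ι ι K) (p : MvPolynomial (ι × ι) K) :
    f (aeval (line B).entries p) =
      aeval (1 + f Polynomial.X • B.map (algebraMap K A)).entries p := by
  rw [← AlgHom.comp_apply]
  congr 1
  apply MvPolynomial.algHom_ext
  rintro ⟨i, j⟩
  have h : f (Polynomial.C (B i j)) = algebraMap K A (B i j) := f.commutes (B i j)
  have h1 : f ((1 : Matrix ι ι (Polynomial K)) i j) = (1 : Matrix ι ι A) i j := by
    rw [Matrix.one_apply, Matrix.one_apply, apply_ite f, map_one, map_zero]
  rw [AlgHom.comp_apply, aeval_X, aeval_X]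
  change f ((1 : Matrix ι ι (Polynomial K)) i j + Polynomial.X * Polynomial.C (B i j)) =
    (1 : Matrix ι ι A) i j + f Polynomial.X * algebraMap K A (B i j)
  rw [map_add, map_mul, h, h1]

theorem eval_aeval_line (t : K) (B : Matrix ι ι K) (p : MvPolynomial (ι × ι) K) :
    (aeval (line B).entries p).eval t = aeval (1 + t • B).entries p := by
  have hB : B.map (algebraMap K K) = B := by ext; simp
  have := map_aeval_line (Polynomial.aeval t) B p
  rwa [Polynomial.aeval_X, hB, Polynomial.coe_aeval_eq_eval] at this

/-- The invertible matrix `1 + B`, for `B` of square zero. -/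
def onePlus (B : Matrix ι ι K) (hB : B * B = 0) : GL ι K where
  val := 1 + B
  inv := 1 - B
  val_inv := by simp [add_mul, mul_sub, hB]
  inv_val := by simp [sub_mul, mul_add, hB]

/-- An equation of `G` restricted to the line is a polynomial in t with infinitely many zeros, hence
zero; then t = ε may be substituted. -/
theorem isTangent_of_line [Infinite K] {G : Subgroup (GL ι K)} {B : Matrix ι ι K}
    (hB : ∀ t : K, ∃ g ∈ G, g.val = 1 + t • B) : IsTangent G B := by
  intro p hp
  have h0 : aeval (line B).entries p = 0 := by
    refine Polynomial.funext fun t => ?_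
    obtain ⟨g, hg, hgt⟩ := hB t
    rw [eval_aeval_line, ← hgt, Polynomial.eval_zero]
    exact mem_ideal.1 hp g hg
  have := map_aeval_line (Polynomial.aeval (DualNumber.eps : DualNumber K)) B p
  rw [h0, map_zero, Polynomial.aeval_X] at this
  exact this.symm

/-- The line is irreducible: if two closed sets cover it and neither contains it, two nonzero
polynomials in t would have product zero. -/
theorem isPreconnected_line [Infinite K] {s : Set (GL ι K)} {B : Matrix ι ι K}
    (hB : ∀ t : K, ∃ g ∈ s, g.val = 1 + t • B) (hs : ∀ g ∈ s, ∃ t : K, g.val = 1 + t • B) :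
    @IsPreconnected _ (zariski ι K) s := by
  let := zariski ι K
  rw [isPreconnected_iff_subset_of_disjoint_closed]
  intro u v hu hv hsuv _
  obtain ⟨S, rfl⟩ := isClosed_zariski_iff.1 hu
  obtain ⟨S', rfl⟩ := isClosed_zariski_iff.1 hv
  by_contra! hc
  simp only [Set.not_subset, Set.mem_ofPred_eq, not_forall] at hc
  obtain ⟨⟨g, hg, p, hp, hgp⟩, h, hh, q, hq, hhq⟩ := hc
  have hne : ∀ (g : GL ι K) (p : MvPolynomial (ι × ι) K), g ∈ s → aeval g.val.entries p ≠ 0 →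
      aeval (line B).entries p ≠ 0 := by
    intro g p hg hgp h0
    obtain ⟨t, ht⟩ := hs g hg
    rw [ht, ← eval_aeval_line, h0, Polynomial.eval_zero] at hgp
    exact hgp rfl
  refine mul_ne_zero (hne g p hg hgp) (hne h q hh hhq) (Polynomial.funext fun t => ?_)
  obtain ⟨x, hx, hxt⟩ := hB t
  rw [Polynomial.eval_mul, eval_aeval_line, eval_aeval_line, ← hxt, Polynomial.eval_zero,
    mul_eq_zero]
  exact (hsuv hx).imp (fun h => h p hp) (fun h => h q hq)

end General

/-! ### The group generated by the diagonal and unipotent parts -/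

section Blocks

variable {m n K : Type*} [Fintype m] [DecidableEq m] [Fintype n] [DecidableEq n] [Field K]

/-- The block-diagonal part of a matrix. -/
def diagPart {A : Type*} [Zero A] (T : Matrix (m ⊕ n) (m ⊕ n) A) : Matrix (m ⊕ n) (m ⊕ n) A :=
  Matrix.fromBlocks T.toBlocks₁₁ 0 0 T.toBlocks₂₂

theorem diagPart_map {A B F : Type*} [Zero A] [Zero B] [FunLike F A B] [ZeroHomClass F A B]
    (f : F) (T : Matrix (m ⊕ n) (m ⊕ n) A) : (diagPart T).map f = diagPart (T.map f) := by
  rw [diagPart, Matrix.fromBlocks_map, Matrix.map_zero _ (map_zero f),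
    Matrix.map_zero _ (map_zero f)]
  rfl

/-- The equations, over `A`, of the group of matrices `h (1 + B)` with `h ∈ G` block-diagonal and
`B ∈ W` lower left. -/
def SatisfiesBlockEquations (G : Subgroup (GL (m ⊕ n) K))
    (W : Submodule K (Matrix (m ⊕ n) (m ⊕ n) K)) {A : Type*} [CommRing A] [Algebra K A]
    (T : Matrix (m ⊕ n) (m ⊕ n) A) : Prop :=
  (∀ p ∈ ideal G, aeval (diagPart T).entries p = 0) ∧ (∀ i j, T (Sum.inl i) (Sum.inr j) = 0) ∧
    ∀ φ ∈ W.dualAnnihilator, formOver φ A ((diagPart T).adjugate * (T - diagPart T)) = 0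

/-- The polynomials underlying `SatisfiesBlockEquations`. -/
def blockEquations (G : Subgroup (GL (m ⊕ n) K))
    (W : Submodule K (Matrix (m ⊕ n) (m ⊕ n) K)) :
    Set (MvPolynomial ((m ⊕ n) × (m ⊕ n)) K) :=
  {q | ∃ p ∈ ideal G, q = aeval (diagPart (Matrix.mvPolynomialX (m ⊕ n) (m ⊕ n) K)).entries p} ∪
  {q | ∃ i j, q = X (Sum.inl i, Sum.inr j)} ∪
  {q | ∃ φ ∈ W.dualAnnihilator, q = formOver φ _
    ((diagPart (Matrix.mvPolynomialX (m ⊕ n) (m ⊕ n) K)).adjugate *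
      (Matrix.mvPolynomialX (m ⊕ n) (m ⊕ n) K -
        diagPart (Matrix.mvPolynomialX (m ⊕ n) (m ⊕ n) K)))}

/-- The same equations are used over `K`, to describe the group, and over the dual numbers, to
describe its tangent vectors. -/
theorem forall_blockEquations_iff (G : Subgroup (GL (m ⊕ n) K))
    (W : Submodule K (Matrix (m ⊕ n) (m ⊕ n) K)) {A : Type*} [CommRing A] [Algebra K A]
    (T : Matrix (m ⊕ n) (m ⊕ n) A) :
    (∀ q ∈ blockEquations G W, aeval T.entries q = 0) ↔ SatisfiesBlockEquations G W T := by
  set f : MvPolynomial ((m ⊕ n) × (m ⊕ n)) K →ₐ[K] A := aeval T.entries with hf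
  have hX : f.mapMatrix (Matrix.mvPolynomialX (m ⊕ n) (m ⊕ n) K) = T :=
    mapMatrix_aeval_mvPolynomialX T
  have hD : f.mapMatrix (diagPart (Matrix.mvPolynomialX (m ⊕ n) (m ⊕ n) K)) = diagPart T := by
    conv_rhs => rw [← hX]
    exact diagPart_map f _
  have h1 : ∀ p : MvPolynomial ((m ⊕ n) × (m ⊕ n)) K,
      f (aeval (diagPart (Matrix.mvPolynomialX (m ⊕ n) (m ⊕ n) K)).entries p) =
      aeval (diagPart T).entries p := by
    intro p
    rw [← AlgHom.comp_apply, comp_aeval, ← hD]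
    rfl
  have h3 : ∀ φ : Module.Dual K (Matrix (m ⊕ n) (m ⊕ n) K), f (formOver φ _
      ((diagPart (Matrix.mvPolynomialX (m ⊕ n) (m ⊕ n) K)).adjugate *
        (Matrix.mvPolynomialX (m ⊕ n) (m ⊕ n) K -
          diagPart (Matrix.mvPolynomialX (m ⊕ n) (m ⊕ n) K)))) =
      formOver φ A ((diagPart T).adjugate * (T - diagPart T)) := by
    intro φ
    have h : f.mapMatrix ((diagPart (Matrix.mvPolynomialX (m ⊕ n) (m ⊕ n) K)).adjugate *
        (Matrix.mvPolynomialX (m ⊕ n) (m ⊕ n) K -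
          diagPart (Matrix.mvPolynomialX (m ⊕ n) (m ⊕ n) K))) =
        (diagPart T).adjugate * (T - diagPart T) := by
      rw [map_mul, map_sub, AlgHom.map_adjugate, hD, hX]
    rw [map_formOver, h]
  constructor
  · intro h
    refine ⟨fun p hp => ?_, fun i j => ?_, fun φ hφ => ?_⟩
    · rw [← h1]
      exact h _ (Or.inl (Or.inl ⟨p, hp, rfl⟩))
    · have := h _ (Or.inl (Or.inr ⟨i, j, rfl⟩))
      rwa [hf, aeval_X] at this
    · rw [← h3]
      exact h _ (Or.inr ⟨φ, hφ, rfl⟩)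
  · rintro ⟨e1, e2, e3⟩ q ((⟨p, hp, rfl⟩ | ⟨i, j, rfl⟩) | ⟨φ, hφ, rfl⟩)
    · rw [h1]
      exact e1 p hp
    · rw [hf, aeval_X]
      exact e2 i j
    · rw [h3]
      exact e3 φ hφ

variable {G : Subgroup (GL (m ⊕ n) K)} {W : Submodule K (Matrix (m ⊕ n) (m ⊕ n) K)}

/-- `G` normalizes the vector group, so the subgroup they generate is their product set. -/
theorem mem_sup_vectorGroup_iff (hW : IsLowerLeft W)
    (hconj : ∀ g ∈ G, ∀ B ∈ W, g.val * B * g⁻¹.val ∈ W) (g : GL (m ⊕ n) K) :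
    g ∈ G ⊔ vectorGroup W hW ↔ ∃ h ∈ G, ∃ B ∈ W, g.val = h.val * (1 + B) := by
  have hmem : ∀ h ∈ G, ∀ v ∈ vectorGroup W hW, h * v * h⁻¹ ∈ vectorGroup W hW := by
    rintro h hh v ⟨B, hB, hv⟩
    refine ⟨_, hconj h hh B hB, ?_⟩
    rw [Units.val_mul, Units.val_mul, hv, mul_add, add_mul, mul_one, ← Units.val_mul,
      mul_inv_cancel, Units.val_one]
  have hnorm : G ≤ Subgroup.normalizer (vectorGroup W hW : Set (GL (m ⊕ n) K)) := by
    intro h hh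
    rw [Subgroup.mem_normalizer_iff]
    intro v
    refine ⟨hmem h hh v, fun hv => ?_⟩
    have := hmem h⁻¹ (G.inv_mem hh) _ hv
    simpa [mul_assoc] using this
  rw [← SetLike.mem_coe, Subgroup.coe_mul_of_left_le_normalizer_right _ _ hnorm, Set.mem_mul]
  constructor
  · rintro ⟨h, hh, v, ⟨B, hB, hv⟩, rfl⟩
    exact ⟨h, hh, B, hB, by rw [Units.val_mul, hv]⟩
  · rintro ⟨h, hh, B, hB, hg⟩
    exact ⟨h, hh, onePlus B (hW.mul_eq_zero hB hB), ⟨B, hB, rfl⟩, Units.ext hg.symm⟩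

theorem satisfiesBlockEquations_of_eq (hG : IsBlockDiagonal G) (hW : IsLowerLeft W)
    {g h : GL (m ⊕ n) K} (hh : h ∈ G) {B : Matrix (m ⊕ n) (m ⊕ n) K} (hB : B ∈ W)
    (hg : g.val = h.val * (1 + B)) : SatisfiesBlockEquations G W g.val := by
  obtain ⟨a, d, had⟩ := hG h hh
  obtain ⟨x, hx⟩ := hW B hB
  have hgb : g.val = Matrix.fromBlocks a 0 (d * x) d := by
    rw [hg, mul_add, mul_one, had, hx, Matrix.fromBlocks_multiply, Matrix.fromBlocks_add]
    simp
  have hdiag : diagPart g.val = h.val := by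
    rw [hgb, had, diagPart, Matrix.toBlocks_fromBlocks₁₁, Matrix.toBlocks_fromBlocks₂₂]
  refine ⟨fun p hp => ?_, fun i j => ?_, fun φ hφ => ?_⟩
  · rw [hdiag]
    exact mem_ideal.1 hp h hh
  · rw [hgb]
    rfl
  · rw [hdiag, hg, mul_add, mul_one, add_sub_cancel_left, ← mul_assoc, Matrix.adjugate_mul,
      Matrix.smul_mul, one_mul, map_smul, formOver_self,
      (mem_iff_forall_dualAnnihilator W B).1 hB φ hφ, smul_zero]

theorem exists_eq_of_satisfiesBlockEquations (hG : IsAlgebraicGroup G) {g : GL (m ⊕ n) K}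
    (hg : SatisfiesBlockEquations G W g.val) : ∃ h ∈ G, ∃ B ∈ W, g.val = h.val * (1 + B) := by
  obtain ⟨e1, e2, e3⟩ := hg
  have hgb : g.val = Matrix.fromBlocks g.val.toBlocks₁₁ 0 g.val.toBlocks₂₁ g.val.toBlocks₂₂ := by
    conv_lhs => rw [← Matrix.fromBlocks_toBlocks g.val]
    congr 1
    ext i j
    exact e2 i j
  have hdet : (diagPart g.val).det ≠ 0 := by
    have := det_ne_zero g
    rw [hgb, Matrix.det_fromBlocks_zero₁₂] at this
    rwa [diagPart, Matrix.det_fromBlocks_zero₁₂]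
  set h : GL (m ⊕ n) K := Matrix.GeneralLinearGroup.mkOfDetNeZero _ hdet
  have hh : h.val = diagPart g.val := rfl
  rw [← hh] at e1 e3
  -- The decomposition is forced: h is the diagonal part of g, and g = h (1 + B) gives B.
  refine ⟨h, hG.mem_of_forall_ideal e1, h⁻¹.val * (g.val - h.val), ?_, ?_⟩
  · rw [mem_iff_forall_dualAnnihilator]
    intro φ hφ
    have := e3 φ hφ
    rw [adjugate_eq_det_smul_inv, Matrix.smul_mul, map_smul, formOver_self, smul_eq_mul,
      mul_eq_zero] at this
    exact this.resolve_left (det_ne_zero h)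
  · rw [mul_add, ← mul_assoc, ← Units.val_mul, mul_inv_cancel, Units.val_one]
    simp

theorem mem_sup_vectorGroup_iff_satisfies (hG : IsAlgebraicGroup G) (hGb : IsBlockDiagonal G)
    (hW : IsLowerLeft W) (hconj : ∀ g ∈ G, ∀ B ∈ W, g.val * B * g⁻¹.val ∈ W)
    (g : GL (m ⊕ n) K) :
    g ∈ G ⊔ vectorGroup W hW ↔ SatisfiesBlockEquations G W g.val := by
  rw [mem_sup_vectorGroup_iff hW hconj]
  constructor
  · rintro ⟨h, hh, B, hB, hg⟩
    exact satisfiesBlockEquations_of_eq hGb hW hh hB hg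
  · exact exists_eq_of_satisfiesBlockEquations hG

theorem isAlgebraicGroup_sup_vectorGroup (hG : IsAlgebraicGroup G) (hGb : IsBlockDiagonal G)
    (hW : IsLowerLeft W) (hconj : ∀ g ∈ G, ∀ B ∈ W, g.val * B * g⁻¹.val ∈ W) :
    IsAlgebraicGroup (G ⊔ vectorGroup W hW) := by
  refine isClosed_zariski_iff.2 ⟨blockEquations G W, Set.ext fun g => ?_⟩
  rw [SetLike.mem_coe, mem_sup_vectorGroup_iff_satisfies hG hGb hW hconj,
    ← forall_blockEquations_iff]
  rfl

/-- An element h (1 + B) is joined to 1 inside the group by `G` and the translated line of all h (1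
+ tB), which meet at h. Only left translations need to be continuous. -/
theorem isZariskiConnected_sup_vectorGroup [Infinite K] (hG : IsZariskiConnected G)
    (hW : IsLowerLeft W) (hconj : ∀ g ∈ G, ∀ B ∈ W, g.val * B * g⁻¹.val ∈ W) :
    IsZariskiConnected (G ⊔ vectorGroup W hW) := by
  let := zariski (m ⊕ n) K
  refine ⟨⟨1, Subgroup.one_mem _⟩, isPreconnected_of_forall 1 ?_⟩
  intro g hg
  obtain ⟨h, hh, B, hB, hgh⟩ := (mem_sup_vectorGroup_iff hW hconj g).1 hg
  set L : Set (GL (m ⊕ n) K) := {v | ∃ t : K, v.val = 1 + t • B}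
  have hL : IsPreconnected L := isPreconnected_line (B := B)
    (fun t => ⟨onePlus (t • B) (hW.mul_eq_zero (W.smul_mem t hB) (W.smul_mem t hB)),
      ⟨t, rfl⟩, rfl⟩) (fun v hv => hv)
  have hhL : IsPreconnected ((h * ·) '' L) :=
    hL.image _ (continuous_mul_left_zariski h).continuousOn
  refine ⟨(G : Set _) ∪ (h * ·) '' L, ?_, Or.inl G.one_mem, Or.inr ?_, ?_⟩
  · rintro x (hx | ⟨v, ⟨t, hv⟩, rfl⟩)
    · exact (le_sup_left : G ≤ G ⊔ vectorGroup W hW) hx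
    · exact (mem_sup_vectorGroup_iff hW hconj _).2
        ⟨h, hh, t • B, W.smul_mem t hB, by rw [Units.val_mul, hv]⟩
  · refine ⟨onePlus B (hW.mul_eq_zero hB hB), ⟨1, by rw [one_smul]; rfl⟩, Units.ext ?_⟩
    exact hgh.symm
  · exact hG.isPreconnected.union h hh ⟨1, ⟨0, by simp⟩, mul_one h⟩ hhL

theorem diagPart_onePlusEps (N : Matrix (m ⊕ n) (m ⊕ n) K) :
    diagPart (onePlusEps N) = onePlusEps (diagPart N) := by
  ext (i | i) (j | j) <;>
    simp [diagPart, onePlusEps, Matrix.toBlocks₁₁, Matrix.toBlocks₂₂, Matrix.one_apply]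

/-- The block equations hold at 1 + εN. Those on the diagonal say that the diagonal part of N is
tangent to `G`; the linear ones, after cancelling the unit determinant, that the remaining part lies
in `W`. -/
theorem tangentSpace_sup_vectorGroup_le (hG : IsAlgebraicGroup G) (hGb : IsBlockDiagonal G)
    (hW : IsLowerLeft W) (hconj : ∀ g ∈ G, ∀ B ∈ W, g.val * B * g⁻¹.val ∈ W) :
    tangentSpace (G ⊔ vectorGroup W hW) ≤ tangentSpace G ⊔ W := by
  intro N hN
  have hsat : SatisfiesBlockEquations G W (onePlusEps N) := by
    rw [← forall_blockEquations_iff]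
    intro q hq
    refine hN q (mem_ideal.2 fun g hg => ?_)
    rw [mem_sup_vectorGroup_iff_satisfies hG hGb hW hconj, ← forall_blockEquations_iff] at hg
    exact hg q hq
  obtain ⟨e1, -, e3⟩ := hsat
  rw [diagPart_onePlusEps] at e1 e3
  have hsub : N - diagPart N ∈ W := by
    rw [mem_iff_forall_dualAnnihilator]
    intro φ hφ
    have h := e3 φ hφ
    set E : DualNumber K := DualNumber.eps
    set D := (diagPart N).map (algebraMap K (DualNumber K))
    have hdiff : onePlusEps N - onePlusEps (diagPart N) =
        E • (N - diagPart N).map (algebraMap K (DualNumber K)) := by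
      rw [Matrix.map_sub _ (map_sub _), smul_sub, onePlusEps, onePlusEps, add_sub_add_left_eq_sub]
    have hadj : (onePlusEps (diagPart N)).adjugate =
        (onePlusEps (diagPart N)).det • (1 - E • D) :=
      adjugate_onePlusEpsOver K (diagPart N)
    have hEE : (1 - E • D) * (E • (N - diagPart N).map (algebraMap K (DualNumber K))) =
        E • (N - diagPart N).map (algebraMap K (DualNumber K)) := by
      rw [sub_mul, one_mul, Matrix.smul_mul, Matrix.mul_smul, smul_smul,
        DualNumber.eps_mul_eps, zero_smul, sub_zero]
    have hunit : IsUnit (onePlusEps (diagPart N)).det := by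
      refine IsUnit.of_mul_eq_one ((1 - E • D).det) ?_
      rw [← Matrix.det_mul]
      have : onePlusEps (diagPart N) * (1 - E • D) = 1 := by
        change (1 + E • D) * (1 - E • D) = 1
        simp [mul_sub, add_mul, smul_smul, E, DualNumber.eps_mul_eps]
      rw [this, Matrix.det_one]
    rw [hdiff, hadj, Matrix.smul_mul, hEE, map_smul, map_smul, smul_eq_mul,
      hunit.mul_right_eq_zero, formOver_map_algebraMap] at h
    have := congrArg TrivSqZeroExt.snd h
    simpa [E, TrivSqZeroExt.algebraMap_eq_inl] using this
  rw [← add_sub_cancel (diagPart N) N]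
  exact Submodule.add_mem_sup e1 hsub

theorem le_tangentSpace_vectorGroup [Infinite K] (hW : IsLowerLeft W) :
    W ≤ tangentSpace (vectorGroup W hW) := fun B hB => isTangent_of_line fun t =>
  ⟨onePlus (t • B) (hW.mul_eq_zero (W.smul_mem t hB) (W.smul_mem t hB)),
    ⟨t • B, W.smul_mem t hB, rfl⟩, rfl⟩

theorem tangentSpace_sup_vectorGroup [Infinite K] (hG : IsAlgebraicGroup G)
    (hGb : IsBlockDiagonal G) (hW : IsLowerLeft W)
    (hconj : ∀ g ∈ G, ∀ B ∈ W, g.val * B * g⁻¹.val ∈ W) :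
    tangentSpace (G ⊔ vectorGroup W hW) = tangentSpace G ⊔ W := by
  refine le_antisymm (tangentSpace_sup_vectorGroup_le hG hGb hW hconj) (sup_le ?_ ?_)
  · exact fun N hN => IsTangent.mono le_sup_left hN
  · exact fun B hB => IsTangent.mono le_sup_right (le_tangentSpace_vectorGroup hW hB)

/-- Matrices tangent to a block-diagonal group are block-diagonal. -/
theorem IsBlockDiagonal.eq_fromBlocks (hG : IsBlockDiagonal G) {N : Matrix (m ⊕ n) (m ⊕ n) K}
    (hN : N ∈ tangentSpace G) :
    N = Matrix.fromBlocks N.toBlocks₁₁ 0 0 N.toBlocks₂₂ := by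
  have hzero : ∀ x : (m ⊕ n) × (m ⊕ n), (∀ g ∈ G, g.val.entries x = 0) → N.entries x = 0 := by
    intro x hx
    have h := isTangent_iff.1 hN (X x) (mem_ideal.2 fun g hg => by rw [aeval_X]; exact hx g hg)
    rw [Finset.sum_eq_single x] at h
    · simpa using h
    · intro y _ hy
      simp [pderiv_X_of_ne hy.symm]
    · simp
  conv_lhs => rw [← Matrix.fromBlocks_toBlocks N]
  congr 1
  · ext i j
    refine hzero (Sum.inl i, Sum.inr j) fun g hg => ?_
    obtain ⟨a, d, h⟩ := hG g hg
    rw [h]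
    rfl
  · ext i j
    refine hzero (Sum.inr i, Sum.inl j) fun g hg => ?_
    obtain ⟨a, d, h⟩ := hG g hg
    rw [h]
    rfl

theorem disjoint_tangentSpace (hG : IsBlockDiagonal G) (hW : IsLowerLeft W) :
    Disjoint (tangentSpace G) W := by
  rw [Submodule.disjoint_def]
  intro N hN hNW
  obtain ⟨x, rfl⟩ := hW N hNW
  have h := hG.eq_fromBlocks hN
  rw [h]
  simp

end Blocks

end LinAlgGroup

/-! ### The main theorem -/

theorem mainTheorem6 {C : Type*} [Field C] [IsAlgClosed C] [CharZero C] (n₁ n₂ : ℕ)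
    (hdiag : LieSubalgebra C (Matrix (Fin n₁ ⊕ Fin n₂) (Fin n₁ ⊕ Fin n₂) C))
    (hsub : Submodule C (Matrix (Fin n₁ ⊕ Fin n₂) (Fin n₁ ⊕ Fin n₂) C))
    (hlow : LinAlgGroup.IsLowerLeft hsub)
    (hstable : ∀ (N₁ : Matrix (Fin n₁) (Fin n₁) C) (N₂ : Matrix (Fin n₂) (Fin n₂) C)
      (X : Matrix (Fin n₂) (Fin n₁) C),
      Matrix.fromBlocks N₁ 0 0 N₂ ∈ hdiag → Matrix.fromBlocks 0 0 X 0 ∈ hsub →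
        Matrix.fromBlocks 0 0 (N₂ * X - X * N₁) 0 ∈ hsub)
    (Hdiag : Subgroup (GL (Fin n₁ ⊕ Fin n₂) C))
    (halg : LinAlgGroup.IsAlgebraicGroup Hdiag) (hconn : LinAlgGroup.IsZariskiConnected Hdiag)
    (hblock : LinAlgGroup.IsBlockDiagonal Hdiag) (hLie : LinAlgGroup.lieAlgebra Hdiag = hdiag) :
    LinAlgGroup.IsAlgebraicGroup (Hdiag ⊔ LinAlgGroup.vectorGroup hsub hlow) ∧
    LinAlgGroup.IsZariskiConnected (Hdiag ⊔ LinAlgGroup.vectorGroup hsub hlow) ∧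
    Disjoint hdiag.toSubmodule hsub ∧
    (LinAlgGroup.lieAlgebra (Hdiag ⊔ LinAlgGroup.vectorGroup hsub hlow)).toSubmodule = hdiag.toSubmodule ⊔ hsub ∧
    ∃ h : LieSubalgebra C (Matrix (Fin n₁ ⊕ Fin n₂) (Fin n₁ ⊕ Fin n₂) C),
      h.toSubmodule = hdiag.toSubmodule ⊔ hsub ∧ LinAlgGroup.IsAlgebraicLie h := by
  subst hLie
  have hinf : Infinite C := IsAlgClosed.instInfinite
  have hconj : ∀ g ∈ Hdiag, ∀ B ∈ hsub, g.val * B * g⁻¹.val ∈ hsub := by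
    -- For block-diagonal N, the commutator with a lower-left matrix has the single block N₂X - XN₁,
    -- so `hstable` is the required stability.
    refine LinAlgGroup.conj_mem_of_lie_mem hconn fun N hN B hB => ?_
    obtain ⟨X, rfl⟩ := hlow B hB
    have hN' := hblock.eq_fromBlocks hN
    have h := hstable N.toBlocks₁₁ N.toBlocks₂₂ X (hN' ▸ hN) hB
    rw [hN', Matrix.fromBlocks_multiply, Matrix.fromBlocks_multiply, sub_eq_add_neg,
      Matrix.fromBlocks_neg, Matrix.fromBlocks_add]
    simpa [sub_eq_add_neg] using h
  have hclosed := LinAlgGroup.isAlgebraicGroup_sup_vectorGroup halg hblock hlow hconj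
  have htangent := LinAlgGroup.tangentSpace_sup_vectorGroup halg hblock hlow hconj
  exact ⟨hclosed, LinAlgGroup.isZariskiConnected_sup_vectorGroup hconn hlow hconj,
    LinAlgGroup.disjoint_tangentSpace hblock hlow, htangent,
    LinAlgGroup.lieAlgebra _, htangent, _, hclosed, rfl⟩
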